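/- Let $G$ be a finite group. A compact $G$-metric space is a compact metric space with an action of $G$ by isometries; a $G$-map is a continuous $G$-equivariant map. For a compact $G$-metric space $X$ and $r>0$ consider the following $G$-spaces. - $|\mathrm{VR}(X;r)|$ is the geometric realization (with the weak topology) of the open Vietoris–Rips complex, whose simplices are the nonempty finite subsets of $X$ of diameter $<r$; $G$ acts by $g\cdot\sum u_ix_i=\sum u_i\,(g x_i)$. - $\mathrm{VR}^{\mathrm m}_\infty(X;r)$ is the set of finitely supported Borel probability measures on $X$ whose support has diameter $<r$, with the topology of weak convergence; $G$ acts by push-forward. - $B_r(X,\mathbf E(X))=\{f\in\mathbf E(X):\|f-d_X(x,\cdot)\|_\infty<r\text{ for some }x\in X\}$. Here $\mathbf E(X)$ is the tight span of $X$: the set of pointwise minimal elements of $\Delta(X)=\{f:X\to\mathbb R\text{ bounded}: f(x)+f(x')\ge d_X(x,x')\ \forall x,x'\in X\}$, with the sup metric; $G$ acts by $(g\cdot f)(x)=f(g^{-1}x)$. For compact $G$-metric spaces $X,Y$ define, for $\varepsilon>0$, $$c_{\mathrm{VR}}^G(X,Y;\varepsilon)=\inf\{\eta>0:\text{there is a }G\text{-map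 }|\mathrm{VR}(Y;\varepsilon)|\to|\mathrm{VR}(X;\varepsilon+\eta)|\},$$ $$c_{\mathrm{VR}}^G(X,Y;0)=\inf\{\eta>0:\text{there is a }G\text{-map }Y\to|\mathrm{VR}(X;\eta)|\},$$ and define $c_\infty^G(X,Y;\varepsilon)$ and $c_{\mathbf E}^G(X,Y;\varepsilon)$ for $\varepsilon\ge0$ in the same way, with $\mathrm{VR}^{\mathrm m}_\infty(\,\cdot\,;r)$, respectively $B_r(\,\cdot\,,\mathbf E(\,\cdot\,))$, in place of $|\mathrm{VR}(\,\cdot\,;r)|$ (and $\inf\emptyset=+\infty$). Let $\mathrm{Sep}^G(X)=\inf\{d_X(x,gx):x\in X,\ 1\neq g\in G\}$, which is $+\infty$ if $G$ is trivial. **Proposition.** Let $G$ be a finite group and let $X$, $Y$ be compact $G$-metric spaces. 1. (a) $c_\infty^G(X,Y;0)=c_{\mathrm{VR}}^G(X,Y;0)$. (b) For every $\varepsilon>0$, $$c_{\mathrm{VR}}^G(X,Y;\varepsilon)\le c_\infty^G(X,Y;\varepsilon)\le\inf_{\delta>0}\{c_{\mathrm{VR}}^G(X,Y;\varepsilon+\delta)+\delta\}.$$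 2. (a) $c_{\mathrm{VR}}^G(X,Y;0)\le 2c_{\mathbf E}^G(X,Y;0)$. If moreover $\mathrm{Sep}^G(X)>0$ and either $c_{\mathrm{VR}}^G(X,Y;0)<\mathrm{Sep}^G(X)$ or $2c_{\mathbf E}^G(X,Y;0)<\mathrm{Sep}^G(X)$, then $c_{\mathrm{VR}}^G(X,Y;0)=2c_{\mathbf E}^G(X,Y;0)$. (b) Suppose that $\mathrm{Sep}^G(X)>0$ and $\mathrm{Sep}^G(Y)>0$, and let $0<\varepsilon\le\mathrm{Sep}^G(Y)/2$ be a real number. If either $c_{\mathrm{VR}}^G(X,Y;2\varepsilon)<\mathrm{Sep}^G(X)-2\varepsilon$ or $2c_{\mathbf E}^G(X,Y;\varepsilon)<\mathrm{Sep}^G(X)-2\varepsilon$, then $c_{\mathrm{VR}}^G(X,Y;2\varepsilon)=2c_{\mathbf E}^G(X,Y;\varepsilon)$. -/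

import Mathlib

open scoped NNReal ENNReal Topology
open MeasureTheory

noncomputable section

namespace GPersistence

/-! ### Geometric realization of an abstract simplicial complex -/

/-- The underlying set of the geometric realization of `K`: formal convex combinations
`∑ w v • v` of vertices whose support is a face of `K`. -/
def Realization {V : Type*} (K : PreAbstractSimplicialComplex V) : Type _ :=
  {w : V →₀ ℝ // (∀ v, 0 ≤ w v) ∧ (w.sum fun _ a => a) = 1 ∧ w.support ∈ K.faces}

/-- The inclusion of the closed standard simplex on the vertices of a face `s` into the
realization. -/
def Realization.ofFace {V : Type*} (K : PreAbstractSimplicialComplex V) (s : K.faces)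
    (u : stdSimplex ℝ (s : Finset V)) : Realization K :=
  ⟨(Finsupp.equivFunOnFinite.symm u.1).mapDomain Subtype.val, by
    classical
    have hsum : ((Finsupp.equivFunOnFinite.symm u.1).mapDomain
        Subtype.val).sum (fun _ a => a) = 1 := by
      rw [Finsupp.sum_mapDomain_index (by simp) (by simp), Finsupp.sum_fintype _ _ (by simp)]
      exact u.2.2
    refine ⟨fun v => ?_, hsum, ?_⟩
    · by_cases hv : v ∈ (s : Finset V)
      · have h := Finsupp.mapDomain_apply (f := fun a : s.1 => (a : V))
          Subtype.val_injective (Finsupp.equivFunOnFinite.symm u.1) ⟨v, hv⟩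
        simp only at h
        rw [h]
        exact u.2.1 ⟨v, hv⟩
      · rw [Finsupp.mapDomain_of_notMem_range]
        simpa using hv
    · refine (K.isRelLowerSet_faces s.2).2 ?_ ?_
      · intro v hv
        have := Finsupp.mapDomain_support hv
        simp only [Finset.mem_image] at this
        obtain ⟨a, -, rfl⟩ := this
        exact a.2
      · rw [Finset.nonempty_iff_ne_empty]
        intro h
        rw [Finsupp.sum, h] at hsum
        simp at hsum⟩

/-- The weak (coherent) topology: a set is open iff its preimage in every closed simplex is. -/
instance {V : Type*} (K : PreAbstractSimplicialComplex V) : TopologicalSpace (Realization K) :=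
  ⨆ s : K.faces, TopologicalSpace.coinduced (Realization.ofFace K s) inferInstance

/-! ### Vietoris–Rips complexes -/

/-- The open Vietoris–Rips complex of `X` at scale `r`: its faces are the nonempty finite subsets
of diameter `< r`. It is empty for `r ≤ 0`. -/
def vietorisRips (X : Type*) [MetricSpace X] (r : ℝ) : PreAbstractSimplicialComplex X where
  faces := {s | s.Nonempty ∧ Metric.diam (s : Set X) < r}
  isRelLowerSet_faces := fun s hs => ⟨hs.1, fun _ hts ht =>
    ⟨ht, (Metric.diam_mono (Finset.coe_subset.2 hts) s.finite_toSet.isBounded).trans_lt hs.2⟩⟩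

/-- The geometric realization `|VR(X; r)|`. -/
abbrev VR (X : Type*) [MetricSpace X] (r : ℝ) : Type _ := Realization (vietorisRips X r)

/-- `G` acts on `|VR(X; r)|` by `g • ∑ uᵢ xᵢ = ∑ uᵢ (g • xᵢ)`. -/
instance VR.instMulAction (G X : Type*) [Group G] [MetricSpace X] [MulAction G X]
    [IsIsometricSMul G X] (r : ℝ) : MulAction G (VR X r) where
  smul g w := ⟨w.1.mapDomain (fun x => g • x), by
    classical
    have hinj : Function.Injective (fun x : X => g • x) := MulAction.injective g
    refine ⟨fun v => ?_, ?_, ?_, ?_⟩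
    · have h := Finsupp.mapDomain_apply hinj w.1 (g⁻¹ • v)
      simp only [smul_inv_smul] at h
      rw [h]
      exact w.2.1 _
    · rw [Finsupp.sum_mapDomain_index (by simp) (by simp)]
      exact w.2.2.1
    · rw [Finsupp.mapDomain_support_of_injective hinj]
      exact w.2.2.2.1.image _
    · rw [Finsupp.mapDomain_support_of_injective hinj, Finset.coe_image,
        (isometry_smul X g).diam_image]
      exact w.2.2.2.2⟩
  one_smul w := Subtype.ext (by
    change w.1.mapDomain (fun x => (1 : G) • x) = w.1
    simp only [one_smul]
    exact Finsupp.mapDomain_id)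
  mul_smul g h w := Subtype.ext (by
    change w.1.mapDomain (fun x => (g * h) • x) =
      (w.1.mapDomain (fun x => h • x)).mapDomain (fun x => g • x)
    rw [← Finsupp.mapDomain_comp]
    simp only [mul_smul]
    rfl)

instance VR.instContinuousConstSMul (G X : Type*) [Group G] [MetricSpace X] [MulAction G X]
    [IsIsometricSMul G X] (r : ℝ) : ContinuousConstSMul G (VR X r) where
  continuous_const_smul g := by
    classical
    refine continuous_iSup_dom.2 fun s => continuous_coinduced_dom.2 ?_
    have hinj : Function.Injective (fun x : X => g • x) := MulAction.injective g
    let t : (vietorisRips X r).faces := ⟨(s : Finset X).image (fun x => g • x),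
      s.2.1.image _, by
        rw [Finset.coe_image, (isometry_smul X g).diam_image]; exact s.2.2⟩
    let e : s.1 → t.1 := fun x =>
      ⟨g • (x : X), Finset.mem_image_of_mem _ x.2⟩
    have hc : Continuous (stdSimplex.map (S := ℝ) e) := stdSimplex.continuous_map e
    have key : (fun w : VR X r => g • w) ∘ Realization.ofFace (vietorisRips X r) s =
        Realization.ofFace (vietorisRips X r) t ∘ stdSimplex.map (S := ℝ) e := by
      funext u
      refine Subtype.ext ?_
      change ((Finsupp.equivFunOnFinite.symm u.1).mapDomain
          Subtype.val).mapDomain (fun x => g • x) =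
        (Finsupp.equivFunOnFinite.symm
          (stdSimplex.map (S := ℝ) e u).1).mapDomain Subtype.val
      have h1 : Finsupp.equivFunOnFinite.symm (stdSimplex.map (S := ℝ) e u).1
          = (Finsupp.equivFunOnFinite.symm u.1).mapDomain e := by
        have he : Function.Injective e := fun a b hab =>
          Subtype.ext (hinj (congrArg Subtype.val hab))
        have hs : Function.Surjective e := by
          rintro ⟨y, hy⟩
          obtain ⟨x, hx, rfl⟩ := Finset.mem_image.1 hy
          exact ⟨⟨x, hx⟩, rfl⟩
        ext y
        obtain ⟨x, rfl⟩ := hs y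
        rw [Finsupp.mapDomain_apply he]
        change FunOnFinite.linearMap ℝ ℝ e u.1 (e x) = u.1 x
        simp [FunOnFinite.linearMap_apply_apply, he.eq_iff, Finset.filter_eq']
      rw [h1, ← Finsupp.mapDomain_comp, ← Finsupp.mapDomain_comp]
      rfl
    rw [key]
    refine Continuous.comp ?_ hc
    exact continuous_iSup_rng (i := t) continuous_coinduced_rng

/-! ### Vietoris–Rips metric thickenings -/

/-- `μ` is a finite combination of Dirac measures. -/
def IsFinitelySupported {X : Type*} [MeasurableSpace X] (μ : ProbabilityMeasure X) : Prop :=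
  ∃ (s : Finset X) (u : X → ℝ≥0∞), (μ : Measure X) = ∑ x ∈ s, u x • Measure.dirac x

/-- The `∞`-Vietoris–Rips metric thickening `VRᵐ_∞(X; r)`: finitely supported Borel probability
measures whose support has diameter `< r`, with the topology of weak convergence. It is empty for
`r ≤ 0`. -/
abbrev VRm (X : Type*) [MetricSpace X] [MeasurableSpace X] [BorelSpace X] (r : ℝ) : Type _ :=
  {μ : ProbabilityMeasure X //
    IsFinitelySupported μ ∧ Metric.diam (μ : Measure X).support < r}

theorem support_map_smul {G X : Type*} [Group G] [MetricSpace X] [MeasurableSpace X]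
    [BorelSpace X] [MulAction G X] [IsIsometricSMul G X] (g : G) (μ : Measure X) :
    (μ.map (fun x => g • x)).support = (fun x => g • x) '' μ.support := by
  ext x
  have hmap : ∀ U : Set X, μ.map (fun x => g • x) U = μ ((fun x => g • x) ⁻¹' U) := fun U =>
    (Homeomorph.smul g).toMeasurableEquiv.map_apply U
  have himg : x ∈ (fun x => g • x) '' μ.support ↔ g⁻¹ • x ∈ μ.support := by
    constructor
    · rintro ⟨y, hy, rfl⟩
      simpa using hy
    · intro h
      exact ⟨_, h, by simp⟩
  rw [himg, Measure.mem_support_iff_forall, Measure.mem_support_iff_forall]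
  constructor
  · intro h U hU
    have hU' : (fun y => g⁻¹ • y) ⁻¹' U ∈ 𝓝 x :=
      (continuous_const_smul g⁻¹).continuousAt.preimage_mem_nhds hU
    have := h _ hU'
    rw [hmap] at this
    simpa [Set.preimage_preimage] using this
  · intro h U hU
    rw [hmap]
    refine h _ ?_
    refine (continuous_const_smul g).continuousAt.preimage_mem_nhds ?_
    simpa using hU

/-- `G` acts on `VRᵐ_∞(X; r)` by push-forward of measures. -/
instance VRm.instMulAction (G X : Type*) [Group G] [MetricSpace X] [MeasurableSpace X]
    [BorelSpace X] [MulAction G X] [IsIsometricSMul G X] (r : ℝ) : MulAction G (VRm X r) where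
  smul g μ := ⟨μ.1.map (f := fun x => g • x) (measurable_const_smul g).aemeasurable, by
    classical
    obtain ⟨⟨s, u, h⟩, hd⟩ := μ.2
    refine ⟨⟨s.image (fun x => g • x), fun x => u (g⁻¹ • x), ?_⟩, ?_⟩
    · rw [ProbabilityMeasure.toMeasure_map, h, Finset.sum_image (by simp),
        Measure.map_finset_sum (measurable_const_smul g).aemeasurable]
      refine Finset.sum_congr rfl fun x _ => ?_
      rw [Measure.map_smul, Measure.map_dirac' (measurable_const_smul g)]
      simp only [inv_smul_smul]
    · rw [ProbabilityMeasure.toMeasure_map, support_map_smul, (isometry_smul X g).diam_image]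
      exact hd⟩
  one_smul μ := Subtype.ext (Subtype.ext (by
    change (μ.1 : Measure X).map (fun x => (1 : G) • x) = (μ.1 : Measure X)
    simp only [one_smul]
    exact Measure.map_id))
  mul_smul g h μ := Subtype.ext (Subtype.ext (by
    change (μ.1 : Measure X).map (fun x => (g * h) • x) =
      ((μ.1 : Measure X).map (fun x => h • x)).map (fun x => g • x)
    rw [Measure.map_map (measurable_const_smul g) (measurable_const_smul h)]
    simp only [mul_smul]
    rfl))

instance VRm.instContinuousConstSMul (G X : Type*) [Group G] [MetricSpace X] [MeasurableSpace X]
    [BorelSpace X] [MulAction G X] [IsIsometricSMul G X] (r : ℝ) :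
    ContinuousConstSMul G (VRm X r) where
  continuous_const_smul g :=
    ((ProbabilityMeasure.continuous_map (continuous_const_smul g)).comp
      continuous_subtype_val).subtype_mk _

/-! ### Tight spans -/

/-- The bounded functions on `X` with the supremum norm. -/
abbrev LInfty (X : Type*) : Type _ := lp (fun _ : X => ℝ) ∞

/-- `Δ(X)`. -/
def deltaSet (X : Type*) [MetricSpace X] : Set (LInfty X) :=
  {f | ∀ x x', dist x x' ≤ f x + f x'}

/-- The tight span `E(X)`: the pointwise minimal elements of `Δ(X)`, with the metric induced by
the supremum norm. -/
def tightSpan (X : Type*) [MetricSpace X] : Set (LInfty X) :=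
  {f | f ∈ deltaSet X ∧ ∀ g ∈ deltaSet X, (∀ x, g x ≤ f x) → g = f}

/-- The function `d(x, ·)`. -/
def distFun {X : Type*} [MetricSpace X] [CompactSpace X] (x : X) : LInfty X :=
  ⟨fun y => dist x y, memℓp_infty ⟨Metric.diam (Set.univ : Set X), by
    rintro _ ⟨y, rfl⟩
    simpa using Metric.dist_le_diam_of_mem isCompact_univ.isBounded
      (Set.mem_univ x) (Set.mem_univ y)⟩⟩

/-- The neighborhood `B_r(X, E(X))` of `X` in its tight span. It is empty for `r ≤ 0`. -/
def tightSpanNhd (X : Type*) [MetricSpace X] [CompactSpace X] (r : ℝ) : Set (LInfty X) :=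
  {f | f ∈ tightSpan X ∧ ∃ x, ‖f - distFun x‖ < r}

/-- The function `x ↦ f (g⁻¹ • x)`. -/
def translate {G X : Type*} [Group G] [MulAction G X] (g : G) (f : LInfty X) : LInfty X :=
  ⟨fun x => f (g⁻¹ • x), memℓp_infty ⟨‖f‖, by
    rintro _ ⟨y, rfl⟩
    exact lp.norm_apply_le_norm ENNReal.top_ne_zero f _⟩⟩

theorem translate_apply {G X : Type*} [Group G] [MulAction G X] (g : G) (f : LInfty X) (x : X) :
    translate g f x = f (g⁻¹ • x) := rfl

theorem norm_translate_sub_le {G X : Type*} [Group G] [MulAction G X] (g : G)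
    (f f' : LInfty X) : ‖translate g f - translate g f'‖ ≤ ‖f - f'‖ :=
  lp.norm_le_of_forall_le (norm_nonneg _) fun x =>
    lp.norm_apply_le_norm ENNReal.top_ne_zero (f - f') (g⁻¹ • x)

theorem translate_distFun {G X : Type*} [Group G] [MetricSpace X] [CompactSpace X]
    [MulAction G X] [IsIsometricSMul G X] (g : G) (x : X) :
    translate g (distFun x) = distFun (g • x) := by
  ext y
  change dist x (g⁻¹ • y) = dist (g • x) y
  rw [← dist_smul g x, smul_inv_smul]

theorem translate_mem_deltaSet {G X : Type*} [Group G] [MetricSpace X]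
    [MulAction G X] [IsIsometricSMul G X] (g : G) {f : LInfty X} (hf : f ∈ deltaSet X) :
    translate g f ∈ deltaSet X := fun x x' => by
  simpa [translate_apply] using hf (g⁻¹ • x) (g⁻¹ • x')

theorem translate_mem_tightSpan {G X : Type*} [Group G] [MetricSpace X]
    [MulAction G X] [IsIsometricSMul G X] (g : G) {f : LInfty X} (hf : f ∈ tightSpan X) :
    translate g f ∈ tightSpan X := by
  refine ⟨translate_mem_deltaSet g hf.1, fun h hh hle => ?_⟩
  have h1 := hf.2 (translate g⁻¹ h) (translate_mem_deltaSet g⁻¹ hh) fun x => by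
    simpa [translate_apply] using hle (g • x)
  rw [← h1]
  ext x
  simp [translate_apply]

/-- `G` acts on `B_r(X, E(X))` by `(g • f)(x) = f (g⁻¹ • x)`, which extends the action on `X`
under `x ↦ d(x, ·)`. -/
instance tightSpanNhd.instMulAction (G X : Type*) [Group G] [MetricSpace X] [CompactSpace X]
    [MulAction G X] [IsIsometricSMul G X] (r : ℝ) : MulAction G (tightSpanNhd X r) where
  smul g f := ⟨translate g f.1, translate_mem_tightSpan g f.2.1, by
    obtain ⟨x, hx⟩ := f.2.2
    refine ⟨g • x, ?_⟩
    rw [← translate_distFun]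
    exact (norm_translate_sub_le g _ _).trans_lt hx⟩
  one_smul f := Subtype.ext (by
    change translate (1 : G) f.1 = f.1
    ext x
    simp [translate_apply])
  mul_smul g h f := Subtype.ext (by
    change translate (g * h) f.1 = translate g (translate h f.1)
    ext x
    simp [translate_apply, mul_smul])

instance tightSpanNhd.instContinuousConstSMul (G X : Type*) [Group G] [MetricSpace X]
    [CompactSpace X] [MulAction G X] [IsIsometricSMul G X] (r : ℝ) :
    ContinuousConstSMul G (tightSpanNhd X r) where
  continuous_const_smul g := by
    have h : LipschitzWith 1 (translate (X := X) g) := LipschitzWith.of_dist_le_mul fun f f' => by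
      rw [dist_eq_norm, dist_eq_norm, NNReal.coe_one, one_mul]
      exact norm_translate_sub_le g f f'
    exact (h.continuous.comp continuous_subtype_val).subtype_mk _

/-! ### Indices -/

/-- There is a continuous `G`-equivariant map from `Y` to `Z`. -/
def HasGMap (G Y Z : Type*) [Group G] [MulAction G Y] [MulAction G Z] [TopologicalSpace Y]
    [TopologicalSpace Z] : Prop :=
  ∃ f : Y →[G] Z, Continuous f

/-- The `G`-index of `Y` in a family of `G`-spaces `Z ξ`, `ξ > 0`: the infimum of all `ξ > 0` such
that there is a `G`-map `Y → Z ξ`; it is `∞` if there is no such `ξ`. -/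
def gIndex (G Y : Type*) (Z : ℝ≥0 → Type*) [Group G] [MulAction G Y] [∀ ξ, MulAction G (Z ξ)]
    [TopologicalSpace Y] [∀ ξ, TopologicalSpace (Z ξ)] : ℝ≥0∞ :=
  ⨅ (ξ : ℝ≥0) (_ : 0 < ξ ∧ HasGMap G Y (Z ξ)), (ξ : ℝ≥0∞)

/-- `c_∞^G(X, Y; ε)`. -/
def cInfty (G X Y : Type*) [Group G]
    [MetricSpace X] [MeasurableSpace X] [BorelSpace X] [MulAction G X] [IsIsometricSMul G X]
    [MetricSpace Y] [MeasurableSpace Y] [BorelSpace Y] [MulAction G Y] [IsIsometricSMul G Y]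
    (ε : ℝ≥0) : ℝ≥0∞ :=
  if ε = 0 then gIndex G Y (fun η => VRm X η)
  else gIndex G (VRm Y ε) (fun η => VRm X (ε + η))

/-- `c_VR^G(X, Y; ε)`. -/
def cVR (G X Y : Type*) [Group G]
    [MetricSpace X] [MulAction G X] [IsIsometricSMul G X]
    [MetricSpace Y] [MulAction G Y] [IsIsometricSMul G Y] (ε : ℝ≥0) : ℝ≥0∞ :=
  if ε = 0 then gIndex G Y (fun η => VR X η)
  else gIndex G (VR Y ε) (fun η => VR X (ε + η))

/-- `c_E^G(X, Y; ε)`. -/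
def cE (G X Y : Type*) [Group G]
    [MetricSpace X] [CompactSpace X] [MulAction G X] [IsIsometricSMul G X]
    [MetricSpace Y] [CompactSpace Y] [MulAction G Y] [IsIsometricSMul G Y] (ε : ℝ≥0) : ℝ≥0∞ :=
  if ε = 0 then gIndex G Y (fun η => tightSpanNhd X η)
  else gIndex G (tightSpanNhd Y ε) (fun η => tightSpanNhd X (ε + η))

/-- The `G`-separation of `X`, the infimum of `d(x, g • x)` over `g ≠ 1` and `x ∈ X`; it is `∞` if
`G` is trivial. -/
def gSep (G X : Type*) [Group G] [MetricSpace X] [MulAction G X] : ℝ≥0∞ :=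
  ⨅ (g : G) (_ : g ≠ 1) (x : X), edist x (g • x)

end GPersistence

end

/-!
The indices are compared by composing four families of `G`-maps.

* Reading barycentric coordinates as masses of Dirac measures maps `|VR(X; r)|` to `VRᵐ_∞(X; r)`
  (`hasGMap_vr_vrm`).
* For `r < r'` there is a `G`-map from `VRᵐ_∞(X; r)` to `|VR(X; r')|` (`hasGMap_vrm_vr`), and for
  `2 r ≤ r'` one from `B_r(X, E(X))` to `|VR(X; r')|` (`hasGMap_tightSpanNhd_vr`). Both sources are
  metrizable, hence paracompact, and both maps come from an equivariant partition of unity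
  subordinate to an open cover indexed by the points of `X`: the measures charging a small ball
  about `x`, respectively the functions with `f x < r`. Local finiteness makes the resulting map
  continuous for the weak topology (`continuous_realization_of_locallyFinite`), and a partition of
  unity becomes equivariant by averaging over the finite group.
* For `r' ≤ 2 r` there is a `G`-map from `|VR(X; r')|` to `B_r(X, E(X))`
  (`hasGMap_vr_tightSpanNhd`). Rescale the barycentric coordinates `w` to a function `v` on `X` of
  maximum `1`, and let `D` be the diameter of `X`. The least constant `s` such that `s + D (1 - v)`
  lies in `Δ(X)` is at most half the diameter of the carrier simplex, so this function takes the
  value `s < r` at a vertex of maximal weight. It depends continuously and equivariantly on `w`, and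
  the canonical `1`-Lipschitz retraction of `Δ(X)` onto `E(X)`, which only decreases functions,
  moves it into `B_r(X, E(X))`. That retraction is the limit of the iterates of
  `f ↦ (f + f*) / 2`, where `f*(x) = sup_y (d(x, y) - f y)`; every step commutes with isometries,
  hence so does the limit.

The maps between `|VR(X; r)|` and `VRᵐ_∞(X; r)` give the comparison of `c_VR` with `c_∞`, up to
arbitrarily small changes of scale. Those between `|VR(X; 2 r)|` and `B_r(X, E(X))` give
`c_VR(2 ε) = 2 c_E(ε)` for every `ε ≥ 0`, because the scales `r` and `2 r` match exactly in
both directions.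
-/

noncomputable section

namespace GPersistence

/-! ### Maps into Vietoris–Rips complexes from open covers -/

/-- An open cover of a paracompact Hausdorff `G`-space that is indexed equivariantly by a `G`-set
carries an equivariant partition of unity: average any subordinate one over `G`. -/
theorem exists_equivariant_partitionOfUnity {G ι Z : Type*} [Group G] [Finite G] [MulAction G ι]
    [MulAction G Z] [TopologicalSpace Z] [ContinuousConstSMul G Z] [ParacompactSpace Z]
    [T2Space Z] (U : ι → Set Z) (hopen : ∀ i, IsOpen (U i)) (hcover : ∀ z, ∃ i, z ∈ U i)
    (hsmul : ∀ (g : G) i z, g • z ∈ U (g • i) → z ∈ U i) :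
    ∃ ψ : PartitionOfUnity ι Z, (∀ (g : G) i z, ψ (g • i) (g • z) = ψ i z) ∧
      ∀ i z, ψ i z ≠ 0 → z ∈ U i := by
  classical
  cases nonempty_fintype G
  obtain ⟨φ, hφ⟩ := PartitionOfUnity.exists_isSubordinate isClosed_univ U hopen
    (fun z _ => Set.mem_iUnion.2 (hcover z))
  have hcard : (0 : ℝ) < Fintype.card G := by exact_mod_cast Fintype.card_pos
  let ψ : ι → C(Z, ℝ) := fun i =>
    ⟨fun z => (Fintype.card G : ℝ)⁻¹ * ∑ g : G, φ (g • i) (g • z), by fun_prop⟩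
  have hψ : ∀ i z, ψ i z = (Fintype.card G : ℝ)⁻¹ * ∑ g : G, φ (g • i) (g • z) :=
    fun _ _ => rfl
  have hex : ∀ i z, ψ i z ≠ 0 → ∃ g : G, φ (g • i) (g • z) ≠ 0 := by
    intro i z h
    by_contra! h'
    exact h (by simp [hψ, h'])
  have hlf : ∀ g : G, LocallyFinite fun i => {z : Z | φ (g • i) (g • z) ≠ 0} := fun g =>
    (φ.locallyFinite.preimage_continuous (continuous_const_smul g)).comp_injective
      (MulAction.injective g)
  have hsum : ∀ z, ∑ᶠ i, ψ i z = 1 := by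
    intro z
    have h1 : ∀ g : G, ∑ᶠ i, φ (g • i) (g • z) = 1 := fun g =>
      (finsum_comp_equiv (MulAction.toPerm g) (f := fun i => φ i (g • z))).trans
        (φ.sum_eq_one (Set.mem_univ _))
    simp only [hψ]
    rw [← mul_finsum, finsum_sum_comm]
    · simp [h1, hcard.ne']
    · exact fun g _ => (hlf g).point_finite z
  refine ⟨⟨ψ, ?_, ?_, fun z _ => hsum z, fun z => (hsum z).le⟩, ?_, ?_⟩
  · intro z
    choose t ht hfin using fun g : G => hlf g z
    refine ⟨⋂ g, t g, Filter.iInter_mem.2 ht, (Set.finite_iUnion hfin).subset ?_⟩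
    rintro i ⟨z', hz', hzt⟩
    obtain ⟨g, hg⟩ := hex i z' hz'
    exact Set.mem_iUnion.2 ⟨g, z', hg, Set.mem_iInter.1 hzt g⟩
  · exact fun i z => mul_nonneg (by positivity)
      (Finset.sum_nonneg fun g _ => φ.nonneg _ _)
  · intro g i z
    change ψ (g • i) (g • z) = ψ i z
    rw [hψ, hψ]
    congr 1
    exact Fintype.sum_equiv (Equiv.mulRight g) _ _ fun h => by simp [mul_smul]
  · intro i z h
    obtain ⟨g, hg⟩ := hex i z h
    exact hsmul g i z (hφ _ (subset_tsupport _ hg))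

/-- A map into a realization is continuous if its barycentric coordinates are continuous and have
locally finite supports. -/
theorem continuous_realization_of_locallyFinite {V Z : Type*} [TopologicalSpace Z]
    {K : PreAbstractSimplicialComplex V} (F : Z → Realization K)
    (hcont : ∀ v, Continuous fun z => (F z).1 v)
    (hlf : LocallyFinite fun v => {z | (F z).1 v ≠ 0}) : Continuous F := by
  classical
  refine continuous_iff_continuousAt.2 fun z₀ => ?_
  obtain ⟨t, ht, hfin⟩ := hlf z₀
  obtain ⟨U, hUt, hU, hzU⟩ := mem_nhds_iff.1 ht
  refine ContinuousOn.continuousAt ?_ (hU.mem_nhds hzU)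
  rw [continuousOn_iff_continuous_domRestrict]
  -- On `U` only the vertices in `S` have nonzero coordinates, so `U` is the union of the finitely
  -- many closed sets that are mapped into the closed simplices spanned by faces inside `S`.
  set S : Finset V := hfin.toFinset
  have hS : ∀ z ∈ U, (F z).1.support ⊆ S := by
    intro z hz v hv
    exact hfin.mem_toFinset.2 ⟨z, Finsupp.mem_support_iff.1 hv, hUt hz⟩
  let I := {s : K.faces // (s : Finset V) ⊆ S}
  have : Finite I := by
    refine Finite.of_injective (β := S.powerset) (fun s => ⟨s.1.1, Finset.mem_powerset.2 s.2⟩) ?_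
    exact fun s s' h => Subtype.ext (Subtype.ext (congrArg (fun a => a.1) h))
  let A : I → Set U := fun s => {z | ∀ v, v ∉ (s.1 : Finset V) → (F z).1 v = 0}
  refine (locallyFinite_of_finite A).continuous ?_ ?_ ?_
  · refine Set.eq_univ_of_forall fun z => Set.mem_iUnion.2
      ⟨⟨⟨(F z).1.support, (F z).2.2.2⟩, hS z z.2⟩, fun v hv => ?_⟩
    simpa using hv
  · intro s
    simp only [A, Set.ofPred_forall]
    exact isClosed_iInter fun v => isClosed_iInter fun _ =>
      isClosed_eq ((hcont v).comp continuous_subtype_val) continuous_const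
  · intro s
    rw [continuousOn_iff_continuous_domRestrict]
    have hsupp : ∀ z : A s, (F z.1).1.support ⊆ (s.1 : Finset V) := by
      intro z v hv
      by_contra h
      exact Finsupp.mem_support_iff.1 hv (z.2 v h)
    let c : A s → stdSimplex ℝ (s.1 : Finset V) := fun z =>
      ⟨fun v => (F z.1).1 v, fun v => (F z.1).2.1 v, by
        refine (Finset.sum_coe_sort (s.1 : Finset V) fun v => (F z.1).1 v).trans ?_
        exact (Finsupp.sum_of_support_subset _ (hsupp z) _ (by simp)).symm.trans (F z.1).2.2.1⟩
    have hc : Continuous c := continuous_induced_rng.2 (continuous_pi fun v =>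
      (hcont v).comp (continuous_subtype_val.comp continuous_subtype_val))
    have key : (A s).domRestrict (U.domRestrict F) = Realization.ofFace K s.1 ∘ c := by
      funext z
      refine Subtype.ext (Finsupp.ext fun v => ?_)
      change (F z.1).1 v =
        (Finsupp.equivFunOnFinite.symm (c z).1).mapDomain Subtype.val v
      by_cases hv : v ∈ (s.1 : Finset V)
      · exact (Finsupp.mapDomain_apply (f := fun a : (s.1 : Finset V) => (a : V))
          Subtype.val_injective (Finsupp.equivFunOnFinite.symm (c z).1) ⟨v, hv⟩).symm
      · rw [Finsupp.mapDomain_of_notMem_range, z.2 v hv]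
        simpa using hv
    rw [key]
    exact (continuous_iSup_rng (i := s.1) continuous_coinduced_rng).comp hc

theorem HasGMap.comp {G Z₁ Z₂ Z₃ : Type*} [Group G] [MulAction G Z₁] [MulAction G Z₂]
    [MulAction G Z₃] [TopologicalSpace Z₁] [TopologicalSpace Z₂] [TopologicalSpace Z₃]
    (h₂ : HasGMap G Z₂ Z₃) (h₁ : HasGMap G Z₁ Z₂) : HasGMap G Z₁ Z₃ := by
  obtain ⟨f₁, hf₁⟩ := h₁
  obtain ⟨f₂, hf₂⟩ := h₂
  exact ⟨f₂.comp f₁, hf₂.comp hf₁⟩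

theorem VR.smul_apply_smul {G X : Type*} [Group G] [MetricSpace X] [MulAction G X]
    [IsIsometricSMul G X] {r : ℝ} (g : G) (w : VR X r) (x : X) : (g • w).1 (g • x) = w.1 x :=
  Finsupp.mapDomain_apply (MulAction.injective g) w.1 x

/-- A finite nonempty set has diameter `< r` as soon as its points are pairwise at distance
`< r`. -/
theorem diam_lt_of_forall_dist_lt {X : Type*} [MetricSpace X] {s : Finset X} (hs : s.Nonempty)
    {r : ℝ} (h : ∀ x ∈ s, ∀ y ∈ s, dist x y < r) : Metric.diam (s : Set X) < r := by
  obtain ⟨p, hp, hmax⟩ := (s ×ˢ s).exists_max_image (fun p => dist p.1 p.2) (hs.product hs)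
  rw [Finset.mem_product] at hp
  refine (Metric.diam_le_of_forall_dist_le dist_nonneg fun x hx y hy => ?_).trans_lt
    (h p.1 hp.1 p.2 hp.2)
  exact hmax (x, y) (Finset.mem_product.2 ⟨hx, hy⟩)

/-- An equivariant open cover `U` of a metrizable `G`-space, indexed by the points of `X` and such
that `U x` meets `U y` only if `dist x y < r`, defines a `G`-map to the Vietoris–Rips complex of
`X` at scale `r`. -/
theorem hasGMap_vr_of_cover {G X Z : Type*} [Group G] [Finite G] [MetricSpace X] [MulAction G X]
    [IsIsometricSMul G X] [MulAction G Z] [TopologicalSpace Z] [ContinuousConstSMul G Z]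
    [ParacompactSpace Z] [T2Space Z] {r : ℝ} (U : X → Set Z) (hopen : ∀ x, IsOpen (U x))
    (hcover : ∀ z, ∃ x, z ∈ U x) (hsmul : ∀ (g : G) x z, g • z ∈ U (g • x) → z ∈ U x)
    (hdist : ∀ z x y, z ∈ U x → z ∈ U y → dist x y < r) : HasGMap G Z (VR X r) := by
  obtain ⟨ψ, hψG, hψU⟩ := exists_equivariant_partitionOfUnity U hopen hcover hsmul
  let w : Z → X →₀ ℝ := fun z =>
    Finsupp.ofSupportFinite (fun x => ψ x z) (ψ.locallyFinite.point_finite z)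
  have hsum : ∀ z, (w z).sum (fun _ a => a) = 1 := by
    intro z
    rw [← ψ.sum_eq_one (Set.mem_univ z)]
    exact (finsum_eq_sum_of_support_subset _ fun x hx => Finsupp.mem_support_iff.2 hx).symm
  have hne : ∀ z, (w z).support.Nonempty := by
    intro z
    rw [Finset.nonempty_iff_ne_empty]
    intro h
    have := hsum z
    rw [Finsupp.sum, h] at this
    simp at this
  let F : Z → VR X r := fun z => ⟨w z, fun x => ψ.nonneg x z, hsum z, hne z,
    diam_lt_of_forall_dist_lt (hne z) fun x hx y hy =>
      hdist z x y (hψU x z (Finsupp.mem_support_iff.1 hx)) (hψU y z (Finsupp.mem_support_iff.1 hy))⟩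
  refine ⟨⟨F, fun g z => Subtype.ext (Finsupp.ext fun x => ?_)⟩,
    continuous_realization_of_locallyFinite F (fun x => (ψ x).continuous) ψ.locallyFinite⟩
  obtain ⟨x, rfl⟩ := MulAction.surjective g x
  exact (hψG g x z).trans (VR.smul_apply_smul g (F z) x).symm

/-! ### Comparison with the metric thickening -/

/-- The finitely supported measure `∑ w x • δ_x` attached to a finitely supported function. -/
def diracSum {X : Type*} [MeasurableSpace X] (w : X →₀ ℝ) : Measure X :=
  ∑ x ∈ w.support, ENNReal.ofReal (w x) • Measure.dirac x

theorem diracSum_eq_of_subset {X : Type*} [MeasurableSpace X] {w : X →₀ ℝ} {s : Finset X}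
    (h : w.support ⊆ s) :
    diracSum w = ∑ x ∈ s, ENNReal.ofReal (w x) • Measure.dirac x :=
  Finset.sum_subset h fun x _ hx => by simp [Finsupp.notMem_support_iff.1 hx]

theorem isProbabilityMeasure_diracSum {X : Type*} [MeasurableSpace X] {w : X →₀ ℝ}
    (h0 : ∀ x, 0 ≤ w x) (h1 : (w.sum fun _ a => a) = 1) : IsProbabilityMeasure (diracSum w) := by
  refine ⟨?_⟩
  simp only [diracSum, Measure.finsetSum_apply, Measure.smul_apply, measure_univ, smul_eq_mul,
    mul_one]
  rw [← ENNReal.ofReal_sum_of_nonneg fun x _ => h0 x]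
  change ENNReal.ofReal (w.sum fun _ a => a) = 1
  rw [h1, ENNReal.ofReal_one]

theorem support_diracSum_subset {X : Type*} [MetricSpace X] [MeasurableSpace X] [BorelSpace X]
    (w : X →₀ ℝ) : (diracSum w).support ⊆ w.support := by
  refine Measure.support_subset_of_isClosed w.support.finite_toSet.isClosed ?_
  rw [mem_ae_iff, diracSum, Measure.finsetSum_apply]
  refine Finset.sum_eq_zero fun x hx => ?_
  rw [Measure.smul_apply, Measure.dirac_apply' _ w.support.measurableSet.compl]
  simp [Finsupp.mem_support_iff.1 hx]

theorem integral_diracSum {X : Type*} [MetricSpace X] [MeasurableSpace X] [BorelSpace X]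
    {w : X →₀ ℝ} (h0 : ∀ x, 0 ≤ w x) {s : Finset X} (h : w.support ⊆ s)
    (f : X → ℝ) : ∫ x, f x ∂(diracSum w) = ∑ x ∈ s, w x * f x := by
  rw [diracSum_eq_of_subset h, integral_finsetSum_measure]
  · refine Finset.sum_congr rfl fun x _ => ?_
    rw [integral_smul_measure, integral_dirac, ENNReal.toReal_ofReal (h0 x), smul_eq_mul]
  · exact fun x _ => (integrable_dirac (by simp)).smul_measure ENNReal.ofReal_ne_top

section Thickening

variable {G X : Type*} [Group G] [MetricSpace X] [MeasurableSpace X] [BorelSpace X]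
  [MulAction G X] [IsIsometricSMul G X]

/-- Reading barycentric coordinates as masses of Dirac measures is a `G`-map: on each simplex
the integral of a continuous function is an affine function of the coordinates. -/
theorem hasGMap_vr_vrm (r : ℝ) : HasGMap G (VR X r) (VRm X r) := by
  classical
  have hprob : ∀ w : VR X r, IsProbabilityMeasure (diracSum w.1) := fun w =>
    isProbabilityMeasure_diracSum w.2.1 w.2.2.1
  let F : VR X r → VRm X r := fun w =>
    ⟨⟨diracSum w.1, hprob w⟩, ⟨w.1.support, fun x => ENNReal.ofReal (w.1 x), rfl⟩,
      (Metric.diam_mono (support_diracSum_subset w.1)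
        w.1.support.finite_toSet.isBounded).trans_lt w.2.2.2.2⟩
  refine ⟨⟨F, fun g w => Subtype.ext (Subtype.ext ?_)⟩, ?_⟩
  · change diracSum (w.1.mapDomain fun x => g • x) = (diracSum w.1).map fun x => g • x
    rw [diracSum, diracSum, Finsupp.mapDomain_support_of_injective (MulAction.injective g),
      Finset.sum_image (by simp), Measure.map_finset_sum (measurable_const_smul g).aemeasurable]
    refine Finset.sum_congr rfl fun x _ => ?_
    rw [Measure.map_smul, Measure.map_dirac' (measurable_const_smul g)]
    congr 2
    exact Finsupp.mapDomain_apply (MulAction.injective g) w.1 x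
  · refine Continuous.subtype_mk (ProbabilityMeasure.continuous_iff_forall_continuous_integral.2
      fun f => continuous_iSup_dom.2 fun s => continuous_coinduced_dom.2 ?_) _
    have hsub : ∀ u, (Realization.ofFace (vietorisRips X r) s u).1.support ⊆ s := by
      intro u v hv
      obtain ⟨a, -, rfl⟩ := Finset.mem_image.1 (Finsupp.mapDomain_support hv)
      exact a.2
    have hcoord : ∀ u (v : (s : Finset X)),
        (Realization.ofFace (vietorisRips X r) s u).1 v = u.1 v := fun u v =>
      Finsupp.mapDomain_apply (f := fun a : (s : Finset X) => (a : X)) Subtype.val_injective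
        (Finsupp.equivFunOnFinite.symm u.1) v
    have key : ∀ u, ∫ x, f x ∂(diracSum (Realization.ofFace (vietorisRips X r) s u).1) =
        ∑ v : (s : Finset X), u.1 v * f v := by
      intro u
      rw [integral_diracSum (Realization.ofFace (vietorisRips X r) s u).2.1 (hsub u),
        ← Finset.sum_coe_sort]
      exact Finset.sum_congr rfl fun v _ => by rw [hcoord]
    refine Continuous.congr (f := fun u : stdSimplex ℝ (s : Finset X) =>
      ∑ v : (s : Finset X), u.1 v * f v) ?_ fun u => (key u).symm
    exact continuous_finsetSum _ fun v _ =>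
      ((continuous_apply v).comp continuous_subtype_val).mul continuous_const

/-- At the cost of an arbitrarily small increase in scale, the metric thickening maps to the
Vietoris–Rips complex: use the cover by the sets of measures that charge a small ball. -/
theorem hasGMap_vrm_vr [Finite G] [CompactSpace X] {r r' : ℝ} (h : r < r') :
    HasGMap G (VRm X r) (VR X r') := by
  have : ParacompactSpace (VRm X r) := by
    have : TopologicalSpace.MetrizableSpace (VRm X r) :=
      Topology.IsEmbedding.subtypeVal.metrizableSpace
    let := TopologicalSpace.metrizableSpaceMetric (VRm X r)
    infer_instance
  set δ := (r' - r) / 2 with hδ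
  have hδ0 : 0 < δ := by rw [hδ]; linarith
  let φ : X → BoundedContinuousFunction X ℝ := fun x =>
    BoundedContinuousFunction.mkOfCompact ⟨fun y => max 0 (δ - dist x y), by fun_prop⟩
  have hφ : ∀ x y, φ x y = max 0 (δ - dist x y) := fun _ _ => rfl
  have hφ0 : ∀ x y, 0 ≤ φ x y := fun x y => le_max_left _ _
  have hpos : ∀ x y, φ x y ≠ 0 ↔ dist x y < δ := by
    intro x y
    rw [hφ, ← (le_max_left 0 (δ - dist x y)).lt_iff_ne']
    simp
  have hint : ∀ x (μ : VRm X r), 0 < ∫ y, φ x y ∂(μ.1 : Measure X) ↔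
      0 < (μ.1 : Measure X) (Metric.ball x δ) := by
    intro x μ
    rw [integral_pos_iff_support_of_nonneg (hφ0 x) ((φ x).integrable _)]
    have : Function.support (φ x) = Metric.ball x δ := by
      ext y
      rw [Function.mem_support, hpos, Metric.mem_ball, dist_comm]
    rw [this]
  have hsupp : ∀ x (μ : VRm X r), 0 < (μ.1 : Measure X) (Metric.ball x δ) →
      ∃ y ∈ (μ.1 : Measure X).support, dist x y < δ := by
    intro x μ hx
    obtain ⟨y, hy, hys⟩ := Measure.nonempty_inter_support_of_pos hx
    exact ⟨y, hys, by rw [dist_comm]; exact hy⟩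
  refine hasGMap_vr_of_cover (fun x => {μ | 0 < ∫ y, φ x y ∂(μ.1 : Measure X)}) ?_ ?_ ?_ ?_
  · exact fun x => isOpen_lt continuous_const
      ((ProbabilityMeasure.continuous_integral_boundedContinuousFunction (φ x)).comp
        continuous_subtype_val)
  · intro μ
    obtain ⟨x, hx⟩ := Measure.nonempty_support (IsProbabilityMeasure.ne_zero (μ.1 : Measure X))
    exact ⟨x, (hint x μ).2 ((Measure.mem_support_iff_forall x).1 hx _ (Metric.ball_mem_nhds x hδ0))⟩
  · intro g x μ hμ
    refine (hint x μ).2 ?_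
    have h1 := (hint _ _).1 hμ
    change 0 < (μ.1 : Measure X).map (fun x => g • x) (Metric.ball (g • x) δ) at h1
    rw [Measure.map_apply (measurable_const_smul g) Metric.isOpen_ball.measurableSet] at h1
    convert h1 using 2
    ext y
    simp
  · intro μ x y hx hy
    obtain ⟨x', hx', hxx⟩ := hsupp x μ ((hint x μ).1 hx)
    obtain ⟨y', hy', hyy⟩ := hsupp y μ ((hint y μ).1 hy)
    have h1 := Metric.dist_le_diam_of_mem
      (isCompact_univ.isBounded.subset (Set.subset_univ (μ.1 : Measure X).support)) hx' hy'
    have h2 := μ.2.2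
    have h3 := dist_triangle4 x x' y' y
    rw [dist_comm y' y] at h3
    linarith

end Thickening

/-! ### The equivariant retraction onto the tight span -/

theorem continuous_translate {G X : Type*} [Group G] [MulAction G X] (g : G) :
    Continuous (translate g : LInfty X → LInfty X) :=
  (LipschitzWith.of_dist_le_mul (K := 1) fun f f' => by
    rw [dist_eq_norm, dist_eq_norm, NNReal.coe_one, one_mul]
    exact norm_translate_sub_le g f f').continuous

section Retraction

variable {X : Type*} [MetricSpace X] [CompactSpace X]

theorem abs_ciSup_sub_ciSup_le {ι : Type*} [Nonempty ι] {a b : ι → ℝ} {C : ℝ}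
    (ha : BddAbove (Set.range a)) (hb : BddAbove (Set.range b)) (h : ∀ i, |a i - b i| ≤ C) :
    |(⨆ i, a i) - ⨆ i, b i| ≤ C := by
  rw [abs_sub_le_iff, sub_le_iff_le_add, sub_le_iff_le_add]
  constructor <;> refine ciSup_le fun i => ?_
  · have := le_ciSup hb i
    linarith [(abs_sub_le_iff.1 (h i)).1]
  · have := le_ciSup ha i
    linarith [(abs_sub_le_iff.1 (h i)).2]

theorem LInfty.abs_apply_le {X : Type*} (f : LInfty X) (x : X) : |f x| ≤ ‖f‖ :=
  lp.norm_apply_le_norm ENNReal.top_ne_zero f x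

theorem LInfty.abs_sub_apply_le {X : Type*} (f g : LInfty X) (x : X) : |f x - g x| ≤ ‖f - g‖ :=
  LInfty.abs_apply_le (f - g) x

theorem dist_le_diam_univ (x y : X) : dist x y ≤ Metric.diam (Set.univ : Set X) :=
  Metric.dist_le_diam_of_mem isCompact_univ.isBounded (Set.mem_univ x) (Set.mem_univ y)

theorem bddAbove_range_dist_sub (f : LInfty X) (x : X) :
    BddAbove (Set.range fun y => dist x y - f y) := by
  refine ⟨Metric.diam (Set.univ : Set X) + ‖f‖, ?_⟩
  rintro _ ⟨y, rfl⟩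
  have h1 := dist_le_diam_univ x y
  have h2 := neg_le_of_abs_le (LInfty.abs_apply_le f y)
  simp only
  linarith

/-- The conjugate `x ↦ sup_y (d(x, y) - f y)` of a bounded function. Every `g ∈ Δ(X)` with
`g ≤ f` lies above it, so the fixed points of conjugation are the minimal elements of `Δ(X)`. -/
def conjugate (f : LInfty X) : LInfty X :=
  ⟨fun x => ⨆ y, (dist x y - f y), memℓp_infty ⟨Metric.diam (Set.univ : Set X) + ‖f‖, by
    rintro _ ⟨x, rfl⟩
    have : Nonempty X := ⟨x⟩
    have h1 := dist_le_diam_univ x x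
    rw [dist_self] at h1
    refine abs_le.2 ⟨?_, ciSup_le fun y => ?_⟩
    · refine le_trans ?_ (le_ciSup (bddAbove_range_dist_sub f x) x)
      rw [dist_self]
      linarith [le_of_abs_le (LInfty.abs_apply_le f x)]
    · linarith [dist_le_diam_univ x y, neg_le_of_abs_le (LInfty.abs_apply_le f y)]⟩⟩

theorem dist_sub_le_conjugate (f : LInfty X) (x y : X) : dist x y - f y ≤ conjugate f x :=
  le_ciSup (bddAbove_range_dist_sub f x) y

theorem conjugate_le {f : LInfty X} {x : X} {c : ℝ} (h : ∀ y, dist x y - f y ≤ c) :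
    conjugate f x ≤ c :=
  have : Nonempty X := ⟨x⟩
  ciSup_le h

theorem conjugate_le_self {f : LInfty X} (hf : f ∈ deltaSet X) (x : X) : conjugate f x ≤ f x :=
  conjugate_le fun y => by linarith [hf x y]

theorem norm_conjugate_sub_le (f g : LInfty X) : ‖conjugate f - conjugate g‖ ≤ ‖f - g‖ := by
  refine lp.norm_le_of_forall_le (norm_nonneg _) fun x => ?_
  have : Nonempty X := ⟨x⟩
  refine abs_ciSup_sub_ciSup_le (bddAbove_range_dist_sub f x) (bddAbove_range_dist_sub g x)
    fun y => ?_
  rw [show dist x y - f y - (dist x y - g y) = -(f y - g y) by ring, abs_neg]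
  exact LInfty.abs_sub_apply_le f g y

theorem conjugate_translate {G : Type*} [Group G] [MulAction G X] [IsIsometricSMul G X] (g : G)
    (f : LInfty X) : conjugate (translate g f) = translate g (conjugate f) := by
  ext x
  change ⨆ y, (dist x y - f (g⁻¹ • y)) = ⨆ y, (dist (g⁻¹ • x) y - f y)
  refine Equiv.iSup_congr (MulAction.toPerm g⁻¹) fun y => ?_
  simp

theorem mem_tightSpan_of_conjugate_eq {f : LInfty X} (hf : f ∈ deltaSet X)
    (h : conjugate f = f) : f ∈ tightSpan X := by
  refine ⟨hf, fun g hg hle => ?_⟩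
  ext x
  refine le_antisymm (hle x) ?_
  rw [← h]
  exact conjugate_le fun y => by linarith [hg x y, hle y]

/-- For a self-conjugate function, the distance to the Kuratowski image of `x` is the value at
`x`. -/
theorem norm_sub_distFun_le {f : LInfty X} (hf : f ∈ deltaSet X) (h : conjugate f = f) (x : X) :
    ‖f - distFun x‖ ≤ f x := by
  have h0 : 0 ≤ f x := by
    have := hf x x
    rw [dist_self] at this
    linarith
  refine lp.norm_le_of_forall_le h0 fun y => ?_
  change |f y - dist x y| ≤ f x
  rw [abs_sub_le_iff]
  constructor
  · have : f y ≤ dist x y + f x := by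
      conv_lhs => rw [← h]
      refine conjugate_le fun z => ?_
      have h1 := dist_sub_le_conjugate f x z
      rw [h] at h1
      linarith [dist_triangle_left y z x]
    linarith
  · linarith [hf x y]

/-- One step of the retraction: the average of a function and its conjugate. -/
def halfStep (f : LInfty X) : LInfty X := (2⁻¹ : ℝ) • (f + conjugate f)

theorem halfStep_apply (f : LInfty X) (x : X) : halfStep f x = 2⁻¹ * (f x + conjugate f x) := rfl

theorem norm_halfStep_sub_le (f g : LInfty X) : ‖halfStep f - halfStep g‖ ≤ ‖f - g‖ := by
  have h : halfStep f - halfStep g = (2⁻¹ : ℝ) • ((f - g) + (conjugate f - conjugate g)) := by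
    rw [halfStep, halfStep, ← smul_sub]
    congr 1
    abel
  rw [h, norm_smul]
  have h1 := norm_add_le (f - g) (conjugate f - conjugate g)
  have h2 := norm_conjugate_sub_le f g
  norm_num
  linarith

theorem halfStep_le {f : LInfty X} (hf : f ∈ deltaSet X) (x : X) : halfStep f x ≤ f x := by
  rw [halfStep_apply]
  linarith [conjugate_le_self hf x]

theorem halfStep_mem_deltaSet (f : LInfty X) : halfStep f ∈ deltaSet X := by
  intro x y
  rw [halfStep_apply, halfStep_apply]
  have h1 := dist_sub_le_conjugate f x y
  have h2 := dist_sub_le_conjugate f y x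
  rw [dist_comm] at h2
  linarith

/-- A half step at least halves the distance to the conjugate. -/
theorem norm_halfStep_sub_conjugate_le {f : LInfty X} (hf : f ∈ deltaSet X) :
    ‖halfStep f - conjugate (halfStep f)‖ ≤ ‖f - conjugate f‖ / 2 := by
  refine lp.norm_le_of_forall_le (by positivity) fun x => ?_
  change |halfStep f x - conjugate (halfStep f) x| ≤ _
  have h1 := conjugate_le_self (halfStep_mem_deltaSet f) x
  -- Conjugation reverses order, and `halfStep f ≤ f`.
  have h2 : conjugate f x ≤ conjugate (halfStep f) x := conjugate_le fun y => by
    linarith [dist_sub_le_conjugate (halfStep f) x y, halfStep_le hf y]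
  have h3 := le_of_abs_le (LInfty.abs_sub_apply_le f (conjugate f) x)
  rw [abs_of_nonneg (by linarith)]
  rw [halfStep_apply] at h1 ⊢
  linarith

theorem halfStep_translate {G : Type*} [Group G] [MulAction G X] [IsIsometricSMul G X] (g : G)
    (f : LInfty X) : halfStep (translate g f) = translate g (halfStep f) := by
  ext x
  rw [halfStep_apply, conjugate_translate]
  rfl

theorem continuous_conjugate : Continuous (conjugate : LInfty X → LInfty X) :=
  (LipschitzWith.of_dist_le_mul (K := 1) fun f f' => by
    rw [dist_eq_norm, dist_eq_norm, NNReal.coe_one, one_mul]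
    exact norm_conjugate_sub_le f f').continuous

theorem LInfty.continuous_apply {X : Type*} (x : X) : Continuous fun f : LInfty X => f x :=
  (LipschitzWith.of_dist_le_mul (K := 1) fun f f' => by
    rw [dist_eq_norm f f', NNReal.coe_one, one_mul]
    exact LInfty.abs_sub_apply_le f f' x).continuous

/-- The limit of iterated half steps. -/
def toTightSpan (f : LInfty X) : LInfty X :=
  Filter.limUnder Filter.atTop fun n => halfStep^[n] f

theorem iterate_halfStep_mem_deltaSet {f : LInfty X} (hf : f ∈ deltaSet X) (n : ℕ) :
    halfStep^[n] f ∈ deltaSet X := by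
  cases n with
  | zero => exact hf
  | succ n =>
    rw [Function.iterate_succ_apply']
    exact halfStep_mem_deltaSet _

theorem norm_iterate_halfStep_sub_conjugate_le {f : LInfty X} (hf : f ∈ deltaSet X) (n : ℕ) :
    ‖halfStep^[n] f - conjugate (halfStep^[n] f)‖ ≤ ‖f - conjugate f‖ / 2 ^ n := by
  induction n with
  | zero => simp
  | succ n ih =>
    rw [Function.iterate_succ_apply', pow_succ, ← div_div]
    exact (norm_halfStep_sub_conjugate_le (iterate_halfStep_mem_deltaSet hf n)).trans (by gcongr)

theorem tendsto_iterate_halfStep {f : LInfty X} (hf : f ∈ deltaSet X) :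
    Filter.Tendsto (fun n => halfStep^[n] f) Filter.atTop (𝓝 (toTightSpan f)) := by
  refine CauchySeq.tendsto_limUnder
    (cauchySeq_of_le_geometric_two (f := fun n => halfStep^[n] f) (C := ‖f - conjugate f‖)
      fun n => ?_)
  have h : halfStep^[n] f - halfStep^[n + 1] f =
      (2⁻¹ : ℝ) • (halfStep^[n] f - conjugate (halfStep^[n] f)) := by
    rw [Function.iterate_succ_apply', halfStep]
    module
  rw [dist_eq_norm, h, norm_smul]
  have := norm_iterate_halfStep_sub_conjugate_le hf n
  rw [div_right_comm]
  norm_num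
  linarith

theorem toTightSpan_mem_deltaSet {f : LInfty X} (hf : f ∈ deltaSet X) :
    toTightSpan f ∈ deltaSet X := fun x y =>
  ge_of_tendsto' ((((LInfty.continuous_apply x).add (LInfty.continuous_apply y)).tendsto _).comp
    (tendsto_iterate_halfStep hf)) fun n => iterate_halfStep_mem_deltaSet hf n x y

theorem toTightSpan_le {f : LInfty X} (hf : f ∈ deltaSet X) (x : X) : toTightSpan f x ≤ f x := by
  refine le_of_tendsto' (((LInfty.continuous_apply x).tendsto _).comp
    (tendsto_iterate_halfStep hf)) fun n => ?_
  induction n with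
  | zero => exact le_rfl
  | succ n ih =>
    refine le_trans ?_ ih
    simp only [Function.comp_apply, Function.iterate_succ_apply']
    exact halfStep_le (iterate_halfStep_mem_deltaSet hf n) x

theorem conjugate_toTightSpan {f : LInfty X} (hf : f ∈ deltaSet X) :
    conjugate (toTightSpan f) = toTightSpan f := by
  have h1 : Filter.Tendsto (fun n => ‖halfStep^[n] f - conjugate (halfStep^[n] f)‖) Filter.atTop
      (𝓝 ‖toTightSpan f - conjugate (toTightSpan f)‖) :=
    ((continuous_id.sub continuous_conjugate).norm.tendsto _).comp (tendsto_iterate_halfStep hf)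
  have h2 : Filter.Tendsto (fun n : ℕ => ‖f - conjugate f‖ / 2 ^ n) Filter.atTop (𝓝 0) :=
    tendsto_const_nhds.div_atTop (tendsto_pow_atTop_atTop_of_one_lt one_lt_two)
  have h3 := le_of_tendsto_of_tendsto' h1 h2 (norm_iterate_halfStep_sub_conjugate_le hf)
  exact (sub_eq_zero.1 (norm_le_zero_iff.1 h3)).symm

theorem norm_toTightSpan_sub_le {f g : LInfty X} (hf : f ∈ deltaSet X) (hg : g ∈ deltaSet X) :
    ‖toTightSpan f - toTightSpan g‖ ≤ ‖f - g‖ := by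
  refine le_of_tendsto' ((tendsto_iterate_halfStep hf).sub (tendsto_iterate_halfStep hg)).norm
    fun n => ?_
  induction n with
  | zero => exact le_rfl
  | succ n ih =>
    rw [Function.iterate_succ_apply', Function.iterate_succ_apply']
    exact (norm_halfStep_sub_le _ _).trans ih

theorem toTightSpan_translate {G : Type*} [Group G] [MulAction G X] [IsIsometricSMul G X] (g : G)
    {f : LInfty X} (hf : f ∈ deltaSet X) :
    toTightSpan (translate g f) = translate g (toTightSpan f) := by
  refine tendsto_nhds_unique (tendsto_iterate_halfStep (translate_mem_deltaSet g hf)) ?_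
  refine (((continuous_translate g).tendsto _).comp (tendsto_iterate_halfStep hf)).congr
    fun n => ?_
  exact (Function.Semiconj.iterate_right (f := translate g)
    (fun h => (halfStep_translate g h).symm) n f)

end Retraction

/-! ### The tight span and the Vietoris–Rips complex -/

/-- An element of `B_r(X, E(X))` takes values `< r` at some points of `X`, and two such points are
at distance `< 2 * r`; so the sublevel conditions `f x < r` define a suitable cover. -/
theorem hasGMap_tightSpanNhd_vr {G X : Type*} [Group G] [Finite G] [MetricSpace X]
    [CompactSpace X] [MulAction G X] [IsIsometricSMul G X] {r r' : ℝ} (h : 2 * r ≤ r') :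
    HasGMap G (tightSpanNhd X r) (VR X r') := by
  refine hasGMap_vr_of_cover (fun x => {f | f.1 x < r}) ?_ ?_ ?_ ?_
  · exact fun x => isOpen_lt ((LInfty.continuous_apply x).comp continuous_subtype_val)
      continuous_const
  · rintro ⟨f, hf, x, hx⟩
    refine ⟨x, lt_of_le_of_lt ?_ hx⟩
    have h1 : f x - dist x x ≤ _ := le_of_abs_le (LInfty.abs_sub_apply_le f (distFun x) x)
    simpa using h1
  · intro g x f hf
    change f.1 (g⁻¹ • g • x) < r at hf
    rwa [inv_smul_smul] at hf
  · intro f x y (hx : f.1 x < r) (hy : f.1 y < r)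
    linarith [f.2.1.1 x y]

section VRToTightSpan

variable {X : Type*} [MetricSpace X] [CompactSpace X]

theorem bddAbove_range_spread (v : LInfty X) : BddAbove (Set.range fun p : X × X =>
    (dist p.1 p.2 - Metric.diam (Set.univ : Set X) * (2 - v p.1 - v p.2)) / 2) := by
  refine ⟨(Metric.diam (Set.univ : Set X) -
    Metric.diam (Set.univ : Set X) * (2 - ‖v‖ - ‖v‖)) / 2, ?_⟩
  rintro _ ⟨p, rfl⟩
  have h1 := le_of_abs_le (LInfty.abs_apply_le v p.1)
  have h2 := le_of_abs_le (LInfty.abs_apply_le v p.2)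
  have h3 := dist_le_diam_univ p.1 p.2
  have h4 : 0 ≤ Metric.diam (Set.univ : Set X) := Metric.diam_nonneg
  simp only
  gcongr

/-- The least constant `s` for which `s + D * (1 - v)` lies in `Δ(X)`, where `D` is the diameter
of `X`. -/
def spread (v : LInfty X) : ℝ :=
  ⨆ p : X × X, (dist p.1 p.2 - Metric.diam (Set.univ : Set X) * (2 - v p.1 - v p.2)) / 2

theorem abs_spread_sub_le [Nonempty X] (v v' : LInfty X) :
    |spread v - spread v'| ≤ Metric.diam (Set.univ : Set X) * ‖v - v'‖ := by
  refine abs_ciSup_sub_ciSup_le (bddAbove_range_spread v) (bddAbove_range_spread v') fun p => ?_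
  have h1 := LInfty.abs_sub_apply_le v v' p.1
  have h2 := LInfty.abs_sub_apply_le v v' p.2
  have h4 : 0 ≤ Metric.diam (Set.univ : Set X) := Metric.diam_nonneg
  have h5 : (dist p.1 p.2 - Metric.diam (Set.univ : Set X) * (2 - v p.1 - v p.2)) / 2 -
      (dist p.1 p.2 - Metric.diam (Set.univ : Set X) * (2 - v' p.1 - v' p.2)) / 2 =
      Metric.diam (Set.univ : Set X) * (((v p.1 - v' p.1) + (v p.2 - v' p.2)) / 2) := by ring
  rw [h5, abs_mul, abs_of_nonneg h4, abs_div, abs_two]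
  gcongr
  linarith [abs_add_le (v p.1 - v' p.1) (v p.2 - v' p.2)]

theorem spread_translate {G X : Type*} [MetricSpace X] [Group G] [MulAction G X]
    [IsIsometricSMul G X] (g : G)
    (v : LInfty X) : spread (translate g v) = spread v := by
  refine Equiv.iSup_congr (MulAction.toPerm g⁻¹) fun p => ?_
  simp [translate_apply]

/-- The function `s + D * (1 - v)` in `Δ(X)`, with `D` the diameter of `X` and `s` the spread
of `v`. It is small where `v` is close to `1`. -/
def raise (v : LInfty X) : LInfty X :=
  ⟨fun x => spread v + Metric.diam (Set.univ : Set X) * (1 - v x),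
    memℓp_infty ⟨|spread v| + Metric.diam (Set.univ : Set X) * (1 + ‖v‖), by
      rintro _ ⟨x, rfl⟩
      have h4 : 0 ≤ Metric.diam (Set.univ : Set X) := Metric.diam_nonneg
      refine (abs_add_le _ _).trans ?_
      rw [abs_mul, abs_of_nonneg h4]
      gcongr
      refine (abs_sub _ _).trans ?_
      rw [abs_one]
      gcongr
      exact LInfty.abs_apply_le v x⟩⟩

theorem raise_apply {X : Type*} [MetricSpace X] [CompactSpace X] (v : LInfty X) (x : X) :
    raise v x = spread v + Metric.diam (Set.univ : Set X) * (1 - v x) := rfl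

theorem raise_mem_deltaSet (v : LInfty X) : raise v ∈ deltaSet X := by
  intro x y
  have h : (dist x y - Metric.diam (Set.univ : Set X) * (2 - v x - v y)) / 2 ≤ spread v :=
    le_ciSup (bddAbove_range_spread v) (x, y)
  rw [raise_apply, raise_apply]
  linarith

theorem continuous_raise [Nonempty X] : Continuous (raise : LInfty X → LInfty X) := by
  have h4 : 0 ≤ Metric.diam (Set.univ : Set X) := Metric.diam_nonneg
  refine (LipschitzWith.of_dist_le' (K := 2 * Metric.diam (Set.univ : Set X))
    fun v v' => ?_).continuous
  rw [dist_eq_norm, dist_eq_norm]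
  refine lp.norm_le_of_forall_le (by positivity) fun x => ?_
  change |raise v x - raise v' x| ≤ _
  have h1 := abs_spread_sub_le v v'
  have h2 : |Metric.diam (Set.univ : Set X) * (v x - v' x)| ≤
      Metric.diam (Set.univ : Set X) * ‖v - v'‖ := by
    rw [abs_mul, abs_of_nonneg h4]
    gcongr
    exact LInfty.abs_sub_apply_le v v' x
  have h3 : raise v x - raise v' x =
      (spread v - spread v') - Metric.diam (Set.univ : Set X) * (v x - v' x) := by
    rw [raise_apply, raise_apply]
    ring
  rw [h3]
  linarith [abs_sub (spread v - spread v') (Metric.diam (Set.univ : Set X) * (v x - v' x))]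

theorem raise_translate {G X : Type*} [MetricSpace X] [CompactSpace X] [Group G] [MulAction G X]
    [IsIsometricSMul G X] (g : G)
    (v : LInfty X) : raise (translate g v) = translate g (raise v) := by
  ext x
  rw [raise_apply, spread_translate]
  rfl

theorem continuousOn_toTightSpan : ContinuousOn (toTightSpan : LInfty X → LInfty X)
    (deltaSet X) :=
  (LipschitzOnWith.of_dist_le_mul (K := 1) fun f hf g hg => by
    rw [dist_eq_norm, dist_eq_norm, NNReal.coe_one, one_mul]
    exact norm_toTightSpan_sub_le hf hg).continuousOn

end VRToTightSpan

theorem norm_translate {G X : Type*} [Group G] [MulAction G X] (g : G) (f : LInfty X) :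
    ‖translate g f‖ = ‖f‖ := by
  have h : ∀ (g : G) (f : LInfty X), ‖translate g f‖ ≤ ‖f‖ := fun g f =>
    lp.norm_le_of_forall_le (norm_nonneg _) fun x => LInfty.abs_apply_le f _
  refine le_antisymm (h g f) ?_
  have h1 := h g⁻¹ (translate g f)
  rwa [show translate g⁻¹ (translate g f) = f by ext x; simp [translate_apply]] at h1

section Coordinates

variable {X : Type*} [MetricSpace X] {r : ℝ}

/-- The barycentric coordinates of a point of `|VR(X; r)|`, as a bounded function on `X`. -/
def VR.coord (w : VR X r) : LInfty X :=
  ⟨fun x => w.1 x, memℓp_infty ⟨1, by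
    rintro _ ⟨x, rfl⟩
    simp only [Real.norm_eq_abs, abs_of_nonneg (w.2.1 x)]
    refine le_trans ?_ w.2.2.1.le
    by_cases hx : x ∈ w.1.support
    · exact Finset.single_le_sum (f := w.1) (fun y _ => w.2.1 y) hx
    · rw [Finsupp.notMem_support_iff.1 hx]
      exact Finset.sum_nonneg fun y _ => w.2.1 y⟩⟩

theorem VR.coord_apply (w : VR X r) (x : X) : VR.coord w x = w.1 x := rfl

theorem VR.continuous_coord : Continuous (VR.coord : VR X r → LInfty X) := by
  refine continuous_iSup_dom.2 fun s => continuous_coinduced_dom.2 ?_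
  refine (LipschitzWith.of_dist_le_mul (K := 1) fun u u' => ?_).continuous
  rw [NNReal.coe_one, one_mul, dist_eq_norm]
  refine lp.norm_le_of_forall_le dist_nonneg fun x => ?_
  change |(Realization.ofFace (vietorisRips X r) s u).1 x -
    (Realization.ofFace (vietorisRips X r) s u').1 x| ≤ _
  by_cases hx : x ∈ (s : Finset X)
  · have h : ∀ u, (Realization.ofFace (vietorisRips X r) s u).1 x = u.1 ⟨x, hx⟩ := fun u =>
      Finsupp.mapDomain_apply (f := fun a : (s : Finset X) => (a : X)) Subtype.val_injective
        (Finsupp.equivFunOnFinite.symm u.1) ⟨x, hx⟩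
    rw [h, h]
    exact dist_le_pi_dist u.1 u'.1 ⟨x, hx⟩
  · have h : ∀ u, (Realization.ofFace (vietorisRips X r) s u).1 x = 0 := fun u =>
      Finsupp.mapDomain_of_notMem_range _ _ (by simpa using hx)
    rw [h, h, sub_zero, abs_zero]
    exact dist_nonneg

theorem VR.coord_smul {G : Type*} [Group G] [MulAction G X] [IsIsometricSMul G X] (g : G)
    (w : VR X r) : VR.coord (g • w) = translate g (VR.coord w) := by
  ext x
  obtain ⟨x, rfl⟩ := MulAction.surjective g x
  rw [translate_apply, inv_smul_smul]
  exact VR.smul_apply_smul g w x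

/-- The largest barycentric coordinate is attained. -/
theorem VR.exists_coord_eq_norm (w : VR X r) :
    ∃ x, 0 < w.1 x ∧ VR.coord w x = ‖VR.coord w‖ := by
  obtain ⟨x, hx, hmax⟩ := w.1.support.exists_max_image w.1 w.2.2.2.1
  have hpos : 0 < w.1 x := (w.2.1 x).lt_of_ne' (Finsupp.mem_support_iff.1 hx)
  refine ⟨x, hpos, le_antisymm (le_of_abs_le (LInfty.abs_apply_le _ x)) ?_⟩
  refine lp.norm_le_of_forall_le hpos.le fun y => ?_
  change |w.1 y| ≤ w.1 x
  rw [abs_of_nonneg (w.2.1 y)]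
  by_cases hy : y ∈ w.1.support
  · exact hmax y hy
  · rw [Finsupp.notMem_support_iff.1 hy]
    exact hpos.le

theorem VR.norm_coord_pos (w : VR X r) : 0 < ‖VR.coord w‖ := by
  obtain ⟨x, hx, h⟩ := w.exists_coord_eq_norm
  rw [← h]
  exact hx

/-- The barycentric coordinates, rescaled to have maximum `1`. -/
def VR.peak (w : VR X r) : LInfty X := ‖VR.coord w‖⁻¹ • VR.coord w

theorem VR.peak_apply (w : VR X r) (x : X) : VR.peak w x = ‖VR.coord w‖⁻¹ * w.1 x := rfl

theorem VR.continuous_peak : Continuous (VR.peak : VR X r → LInfty X) :=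
  (VR.continuous_coord.norm.inv₀ fun w => w.norm_coord_pos.ne').smul VR.continuous_coord

theorem VR.peak_smul {G : Type*} [Group G] [MulAction G X] [IsIsometricSMul G X] (g : G)
    (w : VR X r) : VR.peak (g • w) = translate g (VR.peak w) := by
  rw [VR.peak, VR.coord_smul, norm_translate]
  rfl

theorem VR.exists_peak_eq_one (w : VR X r) : ∃ x, VR.peak w x = 1 := by
  obtain ⟨x, -, h⟩ := w.exists_coord_eq_norm
  refine ⟨x, ?_⟩
  rw [VR.peak_apply, ← VR.coord_apply, h]
  exact inv_mul_cancel₀ w.norm_coord_pos.ne'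

theorem VR.peak_le_one (w : VR X r) (x : X) : VR.peak w x ≤ 1 := by
  rw [VR.peak_apply, inv_mul_le_one₀ w.norm_coord_pos]
  exact le_of_abs_le (LInfty.abs_apply_le (VR.coord w) x)

/-- Pairs of points that do not both lie in the carrier simplex do not contribute to the
spread, because the penalty is then at least the diameter of `X`. -/
theorem VR.spread_peak_le [CompactSpace X] [Nonempty X] (w : VR X r) :
    spread (VR.peak w) ≤ Metric.diam (w.1.support : Set X) / 2 := by
  refine ciSup_le fun p => ?_
  have h1 := w.peak_le_one p.1
  have h2 := w.peak_le_one p.2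
  have h3 := dist_le_diam_univ p.1 p.2
  have h4 : 0 ≤ Metric.diam (Set.univ : Set X) := Metric.diam_nonneg
  have h5 : 0 ≤ Metric.diam (w.1.support : Set X) := Metric.diam_nonneg
  gcongr
  by_cases hp1 : p.1 ∈ w.1.support
  · by_cases hp2 : p.2 ∈ w.1.support
    · have h6 := Metric.dist_le_diam_of_mem w.1.support.finite_toSet.isBounded hp1 hp2
      have h7 := mul_nonneg h4 (show 0 ≤ 2 - w.peak p.1 - w.peak p.2 by linarith)
      linarith
    · have h6 : w.peak p.2 = 0 := by
        rw [VR.peak_apply, Finsupp.notMem_support_iff.1 hp2, mul_zero]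
      have h7 := mul_nonneg h4 (show 0 ≤ 1 - w.peak p.1 by linarith)
      rw [h6]
      linarith
  · have h6 : w.peak p.1 = 0 := by
      rw [VR.peak_apply, Finsupp.notMem_support_iff.1 hp1, mul_zero]
    have h7 := mul_nonneg h4 (show 0 ≤ 1 - w.peak p.2 by linarith)
    rw [h6]
    linarith

end Coordinates

/-- The `G`-map `w ↦ toTightSpan (raise w.peak)`. At a vertex `x` of maximal weight the value of
`raise w.peak` is the spread, which is less than `r`, and the retraction does not increase it. -/
theorem hasGMap_vr_tightSpanNhd {G X : Type*} [Group G] [MetricSpace X]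
    [CompactSpace X] [MulAction G X] [IsIsometricSMul G X] {r r' : ℝ} (h : r' ≤ 2 * r) :
    HasGMap G (VR X r') (tightSpanNhd X r) := by
  rcases isEmpty_or_nonempty X with hX | hX
  · have : IsEmpty (VR X r') := ⟨fun w => hX.elim w.exists_peak_eq_one.choose⟩
    exact ⟨⟨isEmptyElim, fun _ w => isEmptyElim w⟩, continuous_of_const isEmptyElim⟩
  let F : VR X r' → tightSpanNhd X r := fun w => ⟨toTightSpan (raise w.peak),
    mem_tightSpan_of_conjugate_eq (toTightSpan_mem_deltaSet (raise_mem_deltaSet _))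
      (conjugate_toTightSpan (raise_mem_deltaSet _)), by
    obtain ⟨x, hx⟩ := w.exists_peak_eq_one
    refine ⟨x, (norm_sub_distFun_le (toTightSpan_mem_deltaSet (raise_mem_deltaSet _))
      (conjugate_toTightSpan (raise_mem_deltaSet _)) x).trans_lt ?_⟩
    refine (toTightSpan_le (raise_mem_deltaSet _) x).trans_lt ?_
    rw [raise_apply, hx]
    have h1 := w.spread_peak_le
    have h2 := w.2.2.2.2
    linarith⟩
  refine ⟨⟨F, fun g w => Subtype.ext ?_⟩, Continuous.subtype_mk
    (continuousOn_toTightSpan.comp_continuous (continuous_raise.comp VR.continuous_peak)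
      fun w => raise_mem_deltaSet _) _⟩
  change toTightSpan (raise (VR.peak (g • w))) = translate g (toTightSpan (raise w.peak))
  rw [VR.peak_smul, raise_translate, toTightSpan_translate g (raise_mem_deltaSet _)]

/-! ### Comparison of the indices -/

theorem gIndex_le {G Y : Type*} {Z : ℝ≥0 → Type*} [Group G] [MulAction G Y]
    [∀ ξ, MulAction G (Z ξ)] [TopologicalSpace Y] [∀ ξ, TopologicalSpace (Z ξ)] {ξ : ℝ≥0}
    (hξ : 0 < ξ) (h : HasGMap G Y (Z ξ)) : gIndex G Y Z ≤ ξ :=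
  iInf₂_le ξ ⟨hξ, h⟩

theorem le_gIndex {G Y : Type*} {Z : ℝ≥0 → Type*} [Group G] [MulAction G Y]
    [∀ ξ, MulAction G (Z ξ)] [TopologicalSpace Y] [∀ ξ, TopologicalSpace (Z ξ)] {c : ℝ≥0∞}
    (h : ∀ ξ : ℝ≥0, 0 < ξ → HasGMap G Y (Z ξ) → c ≤ ξ) : c ≤ gIndex G Y Z :=
  le_iInf₂ fun ξ hξ => h ξ hξ.1 hξ.2

theorem cVR_eq_two_mul_cE {G X Y : Type*} [Group G] [Finite G]
    [MetricSpace X] [CompactSpace X] [MulAction G X] [IsIsometricSMul G X]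
    [MetricSpace Y] [CompactSpace Y] [MulAction G Y] [IsIsometricSMul G Y]
    (ε : ℝ≥0) : cVR G X Y (2 * ε) = 2 * cE G X Y ε := by
  have htwo : ∀ ξ : ℝ≥0, (2 : ℝ≥0∞) * (ξ / 2 : ℝ≥0) = ξ := fun ξ => by
    rw [← ENNReal.coe_ofNat, ← ENNReal.coe_mul, mul_div_cancel₀ _ two_ne_zero]
  have hdiv : ∀ a b : ℝ≥0∞, a / 2 ≤ b → a ≤ 2 * b := fun a b h => by
    rwa [ENNReal.div_le_iff_le_mul (by simp) (by simp), mul_comm] at h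
  have hdiv' : ∀ (a : ℝ≥0∞) (ξ : ℝ≥0), a ≤ (2 * ξ : ℝ≥0) → a / 2 ≤ ξ := fun a ξ h => by
    rw [ENNReal.div_le_iff_le_mul (by simp) (by simp), mul_comm]
    exact_mod_cast h
  rcases eq_or_ne ε 0 with rfl | hε
  · rw [mul_zero, cVR, cE, if_pos rfl, if_pos rfl]
    refine le_antisymm ?_ (le_gIndex fun ξ hξ h => ?_)
    · refine hdiv _ _ (le_gIndex fun ξ hξ h => hdiv' _ _ ?_)
      exact gIndex_le (mul_pos two_pos hξ) ((hasGMap_tightSpanNhd_vr (by simp)).comp h)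
    · rw [← htwo]
      gcongr
      refine gIndex_le (half_pos hξ) ((hasGMap_vr_tightSpanNhd ?_).comp h)
      push_cast
      linarith
  · rw [cVR, cE, if_neg hε, if_neg (mul_ne_zero two_ne_zero hε)]
    refine le_antisymm ?_ (le_gIndex fun ξ hξ h => ?_)
    · refine hdiv _ _ (le_gIndex fun ξ hξ h => hdiv' _ _ ?_)
      refine gIndex_le (mul_pos two_pos hξ)
        (((hasGMap_tightSpanNhd_vr ?_).comp h).comp (hasGMap_vr_tightSpanNhd ?_))
      · push_cast
        linarith
      · simp
    · rw [← htwo]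
      gcongr
      refine gIndex_le (half_pos hξ)
        (((hasGMap_vr_tightSpanNhd ?_).comp h).comp (hasGMap_tightSpanNhd_vr ?_))
      · push_cast
        linarith
      · simp

theorem cInfty_zero_eq_cVR_zero {G X Y : Type*} [Group G] [Finite G]
    [MetricSpace X] [CompactSpace X] [MeasurableSpace X] [BorelSpace X]
    [MulAction G X] [IsIsometricSMul G X]
    [MetricSpace Y] [MeasurableSpace Y] [BorelSpace Y] [MulAction G Y] [IsIsometricSMul G Y]
    : cInfty G X Y 0 = cVR G X Y 0 := by
  rw [cInfty, cVR, if_pos rfl, if_pos rfl]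
  refine le_antisymm (le_gIndex fun ξ hξ h => gIndex_le hξ ((hasGMap_vr_vrm _).comp h))
    (le_gIndex fun ξ hξ h => ENNReal.le_of_forall_pos_le_add fun δ hδ _ => ?_)
  rw [← ENNReal.coe_add]
  exact gIndex_le (add_pos hξ hδ) ((hasGMap_vrm_vr (by simpa using hδ)).comp h)

theorem cVR_le_cInfty {G X Y : Type*} [Group G] [Finite G]
    [MetricSpace X] [CompactSpace X] [MeasurableSpace X] [BorelSpace X]
    [MulAction G X] [IsIsometricSMul G X]
    [MetricSpace Y] [MeasurableSpace Y] [BorelSpace Y] [MulAction G Y] [IsIsometricSMul G Y]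
    {ε : ℝ≥0} (hε : 0 < ε) : cVR G X Y ε ≤ cInfty G X Y ε := by
  rw [cInfty, cVR, if_neg hε.ne', if_neg hε.ne']
  refine le_gIndex fun ξ hξ h => ENNReal.le_of_forall_pos_le_add fun δ hδ _ => ?_
  rw [← ENNReal.coe_add]
  refine gIndex_le (add_pos hξ hδ) (((hasGMap_vrm_vr ?_).comp h).comp (hasGMap_vr_vrm _))
  have : (0 : ℝ) < δ := hδ
  push_cast
  linarith

theorem cInfty_le_cVR_add {G X Y : Type*} [Group G] [Finite G]
    [MetricSpace X] [MeasurableSpace X] [BorelSpace X] [MulAction G X] [IsIsometricSMul G X]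
    [MetricSpace Y] [CompactSpace Y] [MeasurableSpace Y] [BorelSpace Y]
    [MulAction G Y] [IsIsometricSMul G Y]
    {ε δ : ℝ≥0} (hε : 0 < ε) (hδ : 0 < δ) :
    cInfty G X Y ε ≤ cVR G X Y (ε + δ) + δ := by
  rw [cInfty, cVR, if_neg hε.ne', if_neg (add_pos hε hδ).ne', ← tsub_le_iff_right]
  refine le_gIndex fun ξ hξ h => ?_
  rw [tsub_le_iff_right, ← ENNReal.coe_add]
  refine gIndex_le (add_pos hξ hδ) ?_
  rw [show (ε : ℝ) + ((ξ + δ : ℝ≥0) : ℝ) = ((ε + δ : ℝ≥0) : ℝ) + ξ by push_cast; ring]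
  refine ((hasGMap_vr_vrm _).comp h).comp (hasGMap_vrm_vr ?_)
  simpa using hδ

end GPersistence

end

theorem mainTheorem7 (G X Y : Type*) [Group G] [Finite G]
    [MetricSpace X] [CompactSpace X] [MeasurableSpace X] [BorelSpace X]
    [MulAction G X] [IsIsometricSMul G X]
    [MetricSpace Y] [CompactSpace Y] [MeasurableSpace Y] [BorelSpace Y]
    [MulAction G Y] [IsIsometricSMul G Y] :
    GPersistence.cInfty G X Y 0 = GPersistence.cVR G X Y 0 ∧
    (∀ ε : ℝ≥0, 0 < ε →
      GPersistence.cVR G X Y ε ≤ GPersistence.cInfty G X Y ε ∧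
      GPersistence.cInfty G X Y ε ≤
        ⨅ (δ : ℝ≥0) (_ : 0 < δ), (GPersistence.cVR G X Y (ε + δ) + (δ : ℝ≥0∞))) ∧
    GPersistence.cVR G X Y 0 ≤ 2 * GPersistence.cE G X Y 0 ∧
    (0 < GPersistence.gSep G X →
      (GPersistence.cVR G X Y 0 < GPersistence.gSep G X ∨
        2 * GPersistence.cE G X Y 0 < GPersistence.gSep G X) →
      GPersistence.cVR G X Y 0 = 2 * GPersistence.cE G X Y 0) ∧
    (0 < GPersistence.gSep G X → 0 < GPersistence.gSep G Y →
      ∀ ε : ℝ≥0, 0 < ε → (ε : ℝ≥0∞) ≤ GPersistence.gSep G Y / 2 →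
      (GPersistence.cVR G X Y (2 * ε) < GPersistence.gSep G X - 2 * (ε : ℝ≥0∞) ∨
        2 * GPersistence.cE G X Y ε < GPersistence.gSep G X - 2 * (ε : ℝ≥0∞)) →
      GPersistence.cVR G X Y (2 * ε) = 2 * GPersistence.cE G X Y ε) := by
  have hzero : GPersistence.cVR G X Y 0 = 2 * GPersistence.cE G X Y 0 := by
    simpa using GPersistence.cVR_eq_two_mul_cE (G := G) (X := X) (Y := Y) 0
  exact ⟨GPersistence.cInfty_zero_eq_cVR_zero,
    fun ε hε => ⟨GPersistence.cVR_le_cInfty hε,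
      le_iInf₂ fun δ hδ => GPersistence.cInfty_le_cVR_add hε hδ⟩,
    hzero.le, fun _ _ => hzero, fun _ _ ε _ _ _ => GPersistence.cVR_eq_two_mul_cE ε⟩
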